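/- Let $n\ge 0$. A $\mathbb{Z}_4$-linear code of length $n$ is an additive subgroup $C\subseteq\mathbb{Z}_4^n$; its dual is $C^\perp=\{x\in\mathbb{Z}_4^n:\ \sum_j x_jy_j=0\ \text{for all } y\in C\}$, and its symmetrized weight enumerator is the polynomial $\mathrm{swe}_C(a,b,c)=\sum_{w\in C}a^{n_0(w)}b^{n_1(w)+n_3(w)}c^{n_2(w)}$, where $n_i(w)$ is the number of coordinates of $w$ equal to $i$. The code $C$ is formally self-dual if $\mathrm{swe}_C=\mathrm{swe}_{C^\perp}$. The Construction $\mathrm{A}_4$ lattice of $C$ is $\Lambda_{\mathrm{A}_4}(C)=\tfrac12(C+4\mathbb{Z}^n)\subset\mathbb{R}^n$, where the elements of $\mathbb{Z}_4$ are identified with the integers $0,1,2,3$. For a subset $\Lambda\subset\mathbb{R}^n$ that is a lattice or of the form $\nu\mathbb{Z}^n$, and $\operatorname{Im} z>0$, $q=e^{i\pi z}$, put $\Theta_\Lambda(z)=\sum_{\lambda\in\Lambda}q^{\|\lambda\|^2}$. The secrecy function of a full-rank lattice $\Lambda\subset\mathbb{R}^n$ of volume $\nu^n$ is $\Xi_\Lambda(\tau)=\Theta_{\nu\mathbb{Z}^n}(i\tau)/\Theta_\Lambda(i\tau)$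 for $\tau>0$. Let $\vartheta_3(z)=\sum_{m\in\mathbb{Z}}q^{m^2}$, $\vartheta_4(z)=\sum_{m\in\mathbb{Z}}(-q)^{m^2}$ and $t(\tau)=\vartheta_4(i\tau)/\vartheta_3(i\tau)$ for $\tau>0$. Theorem. Let $C$ be a formally self-dual $\mathbb{Z}_4$-linear code of length $n$, let $\Xi=\Xi_{\Lambda_{\mathrm{A}_4}(C)}$, and define $h_C(t)=\mathrm{swe}_C\bigl(1+t,\sqrt[4]{1-t^4},1-t\bigr)$ for $0<t<1$. Then: 1. For every $\tau>0$ one has $0<t(\tau)<1$ and $$\frac{1}{\Xi(\tau)}=\frac{h_C(t(\tau))}{2^n}=\frac{\mathrm{swe}_C\bigl(1+t(\tau),\sqrt[4]{1-t(\tau)^4},1-t(\tau)\bigr)}{2^n}.$$ 2. Maximizing $\Xi$ on $(0,\infty)$ is equivalent to minimizing $h_C$ on $(0,1)$, in the following sense. (a) A point $\tau_0>0$ is a global maximizer of $\Xi$ on $(0,\infty)$ if and only if $t(\tau_0)$ is a global minimizer of $h_C$ on $(0,1)$. (b) A point $t_0\in(0,1)$ is a global minimizer of $h_C$ on $(0,1)$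 if and only if $t_0=t(\tau_0)$ for some global maximizer $\tau_0>0$ of $\Xi$ on $(0,\infty)$. (c) The number $m=\inf_{0<t<1}h_C(t)$ is positive, and $\sup_{\tau>0}\Xi(\tau)=2^n/m$. -/

import Mathlib

noncomputable section

namespace Z4Secrecy

open Complex

/-! ### Codes over `ℤ/4` -/

/-- The number of coordinates of `c` that are equal to `i`. -/
def coordCount {n : ℕ} (i : ZMod 4) (c : Fin n → ZMod 4) : ℕ :=
  (Finset.univ.filter fun j => c j = i).card

/-- The dual code: all vectors orthogonal to every codeword. A `ℤ/4`-linear code of length `n` is an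
additive subgroup of `(ℤ/4)^n`. -/
def dualCode {n : ℕ} (C : AddSubgroup (Fin n → ZMod 4)) : AddSubgroup (Fin n → ZMod 4) where
  carrier := {x | ∀ y ∈ C, ∑ j, x j * y j = 0}
  zero_mem' := by
    intro y _
    simp
  add_mem' := by
    intro a b ha hb y hy
    simp [add_mul, Finset.sum_add_distrib, ha y hy, hb y hy]
  neg_mem' := by
    intro a ha y hy
    simp [ha y hy]

open Classical in
/-- The symmetrized weight enumerator, as a polynomial in the variables
`a = X 0`, `b = X 1`, `c = X 2`. -/
def swe {n : ℕ} (C : AddSubgroup (Fin n → ZMod 4)) : MvPolynomial (Fin 3) ℤ :=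
  ∑ w : Fin n → ZMod 4 with w ∈ C,
    MvPolynomial.X 0 ^ coordCount 0 w *
      MvPolynomial.X 1 ^ (coordCount 1 w + coordCount 3 w) *
      MvPolynomial.X 2 ^ coordCount 2 w

/-- A code is formally self-dual if it has the same symmetrized weight enumerator as its dual. -/
def FormallySelfDual {n : ℕ} (C : AddSubgroup (Fin n → ZMod 4)) : Prop :=
  swe C = swe (dualCode C)

/-- The function `h_C(t) = swe_C(1 + t, (1 - t^4)^{1/4}, 1 - t)`. -/
def hFun {n : ℕ} (C : AddSubgroup (Fin n → ZMod 4)) (t : ℝ) : ℝ :=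
  MvPolynomial.aeval ![1 + t, (1 - t ^ 4) ^ (1 / 4 : ℝ), 1 - t] (swe C)

/-! ### Lattices and theta series -/

/-- The lattice `ν ℤ^n` in Euclidean space. -/
def scaledIntLattice (n : ℕ) (ν : ℝ) : Submodule ℤ (EuclideanSpace ℝ (Fin n)) where
  carrier := {x | ∃ z : Fin n → ℤ, ∀ j, x j = ν * z j}
  zero_mem' := ⟨0, by simp⟩
  add_mem' := by
    rintro x y ⟨z, hz⟩ ⟨w, hw⟩
    exact ⟨z + w, fun j => by simp [hz j, hw j, mul_add]⟩
  smul_mem' := by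
    rintro k x ⟨z, hz⟩
    exact ⟨k • z, fun j => by simp [hz j]; ring⟩

/-- The Construction A₄ lattice `(1/2)(C + 4 ℤ^n)`, where the elements of `ℤ/4` are identified with
the integers `0, 1, 2, 3`. -/
def constrA4 {n : ℕ} (C : AddSubgroup (Fin n → ZMod 4)) :
    Submodule ℤ (EuclideanSpace ℝ (Fin n)) where
  carrier := {x | ∃ c ∈ C, ∃ z : Fin n → ℤ, ∀ j, x j = (1 / 2 : ℝ) * (((c j).val : ℝ) + 4 * z j)}
  zero_mem' := ⟨0, C.zero_mem, 0, by simp⟩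
  add_mem' := by
    rintro x y ⟨c, hc, z, hz⟩ ⟨d, hd, w, hw⟩
    refine ⟨c + d, C.add_mem hc hd, fun j => z j + w j + ((c j).val + (d j).val : ℕ) / 4, ?_⟩
    intro j
    have h : (((c + d) j).val : ℤ) + 4 * ((((c j).val + (d j).val : ℕ) : ℤ) / 4)
        = (c j).val + (d j).val := by
      rw [Pi.add_apply, ZMod.val_add]
      push_cast
      omega
    have h' : (((c + d) j).val : ℝ) + 4 * (((((c j).val + (d j).val : ℕ) : ℤ) / 4 : ℤ) : ℝ)
        = (c j).val + (d j).val := by exact_mod_cast h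
    rw [PiLp.add_apply, hz j, hw j]
    push_cast at h' ⊢
    linarith
  smul_mem' := by
    rintro k x ⟨c, hc, z, hz⟩
    refine ⟨k • c, C.zsmul_mem hc k, fun j => k * z j + (k * (c j).val) / 4, ?_⟩
    intro j
    have h : (((k • c) j).val : ℤ) + 4 * ((k * ((c j).val : ℤ)) / 4) = k * (c j).val := by
      have h1 : (((k • c) j).val : ℤ) = (k * ((c j).val : ℤ)) % 4 := by
        have h2 : (k • c) j = ((k * ((c j).val : ℤ) : ℤ) : ZMod 4) := by simp
        rw [h2, ZMod.val_intCast]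
        rfl
      rw [h1]
      omega
    have h' : (((k • c) j).val : ℝ) + 4 * (((k * ((c j).val : ℤ)) / 4 : ℤ) : ℝ)
        = k * (c j).val := by exact_mod_cast h
    rw [PiLp.smul_apply, hz j, zsmul_eq_mul]
    push_cast
    linear_combination (-1 / 2 : ℝ) * h'

instance constrA4_discrete {n : ℕ} (C : AddSubgroup (Fin n → ZMod 4)) :
    DiscreteTopology (constrA4 C) := by
  have key : IsOpen ({0} : Set (constrA4 C).toAddSubgroup) := by
    rw [Metric.isOpen_singleton_iff]
    refine ⟨1 / 2, by norm_num, ?_⟩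
    rintro ⟨x, c, hc, z, hz⟩ hx
    have hx' : ‖x‖ < 1 / 2 := by simpa [dist_eq_norm] using hx
    apply Subtype.ext
    ext j
    have h1 : |x j| < 1 / 2 := by
      have := PiLp.norm_apply_le x j
      rw [Real.norm_eq_abs] at this
      linarith
    rw [hz j] at h1
    obtain ⟨h2, h3⟩ := abs_lt.mp h1
    have h4 : (-1 : ℝ) < (((c j).val + 4 * z j : ℤ) : ℝ) := by push_cast; linarith
    have h5 : (((c j).val + 4 * z j : ℤ) : ℝ) < 1 := by push_cast; linarith
    have h6 : ((c j).val + 4 * z j : ℤ) = 0 := by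
      have h4' : (-1 : ℤ) < (c j).val + 4 * z j := by exact_mod_cast h4
      have h5' : ((c j).val + 4 * z j : ℤ) < 1 := by exact_mod_cast h5
      omega
    have h7 : ((c j).val : ℝ) + 4 * z j = 0 := by exact_mod_cast h6
    change x j = 0
    rw [hz j, h7, mul_zero]
  exact discreteTopology_of_isOpen_singleton_zero (G := (constrA4 C).toAddSubgroup) key

instance constrA4_isZLattice {n : ℕ} (C : AddSubgroup (Fin n → ZMod 4)) :
    IsZLattice ℝ (constrA4 C) where
  span_top := by
    rw [eq_top_iff, ← (EuclideanSpace.basisFun (Fin n) ℝ).toBasis.span_eq, Submodule.span_le]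
    rintro _ ⟨i, rfl⟩
    have h : (2 : ℝ) • (EuclideanSpace.basisFun (Fin n) ℝ).toBasis i ∈
        (constrA4 C : Set (EuclideanSpace ℝ (Fin n))) := by
      refine ⟨0, C.zero_mem, Pi.single i 1, fun j => ?_⟩
      by_cases hj : j = i
      · subst hj
        simp
        norm_num
      · simp [hj]
    have h2 := Submodule.smul_mem _ (1 / 2 : ℝ) (Submodule.subset_span (R := ℝ) h)
    rw [smul_smul] at h2
    simpa using h2

/-- The theta series `Θ_Λ(z) = ∑_{λ ∈ Λ} q^{‖λ‖²}`, `q = e^{iπz}`, for `Im z > 0`. -/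
def thetaSeries {n : ℕ} (Λ : Submodule ℤ (EuclideanSpace ℝ (Fin n))) (z : ℂ) : ℂ :=
  ∑' v : Λ, cexp (Real.pi * I * z * (‖(v : EuclideanSpace ℝ (Fin n))‖ : ℂ) ^ 2)

/-- On the imaginary axis theta series are real. -/
theorem thetaSeries_imag {n : ℕ} (Λ : Submodule ℤ (EuclideanSpace ℝ (Fin n))) (τ : ℝ) :
    thetaSeries Λ (I * τ) =
      ((∑' v : Λ, Real.exp (-Real.pi * τ * ‖(v : EuclideanSpace ℝ (Fin n))‖ ^ 2) : ℝ) : ℂ) := by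
  rw [thetaSeries, Complex.ofReal_tsum]
  refine tsum_congr fun v => ?_
  rw [Complex.ofReal_exp]
  congr 1
  push_cast
  linear_combination ((Real.pi : ℂ) * τ * (‖(v : EuclideanSpace ℝ (Fin n))‖ : ℂ) ^ 2) * I_mul_I

/-- The secrecy function `Ξ_Λ(τ) = Θ_{νℤ^n}(iτ) / Θ_Λ(iτ)` of a lattice `Λ` of volume `ν^n`, `τ > 0`.
The quotient is a real number (see `secrecyFunction_ofReal`). -/
def secrecyFunction {n : ℕ} (Λ : Submodule ℤ (EuclideanSpace ℝ (Fin n)))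
    [DiscreteTopology Λ] [IsZLattice ℝ Λ] (τ : ℝ) : ℝ :=
  (thetaSeries (scaledIntLattice n (ZLattice.covolume Λ ^ (1 / n : ℝ))) (I * τ) /
    thetaSeries Λ (I * τ)).re

theorem secrecyFunction_ofReal {n : ℕ} (Λ : Submodule ℤ (EuclideanSpace ℝ (Fin n)))
    [DiscreteTopology Λ] [IsZLattice ℝ Λ] (τ : ℝ) :
    (secrecyFunction Λ τ : ℂ) =
      thetaSeries (scaledIntLattice n (ZLattice.covolume Λ ^ (1 / n : ℝ))) (I * τ) /
        thetaSeries Λ (I * τ) := by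
  rw [secrecyFunction, thetaSeries_imag, thetaSeries_imag, ← Complex.ofReal_div, Complex.ofReal_re]

/-- The Jacobi theta function `ϑ₄(z) = ∑_{m ∈ ℤ} (-q)^{m²}`, `q = e^{iπz}`. The function
`ϑ₃(z) = ∑_{m ∈ ℤ} q^{m²}` is Mathlib's `jacobiTheta`. -/
def theta4 (z : ℂ) : ℂ := ∑' m : ℤ, (-cexp (Real.pi * I * z)) ^ (m ^ 2)

/-- `t(τ) = ϑ₄(iτ) / ϑ₃(iτ)`, which is real (see `thetaRatio_ofReal`). -/
def thetaRatio (τ : ℝ) : ℝ := (theta4 (I * τ) / jacobiTheta (I * τ)).re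

theorem thetaRatio_ofReal (τ : ℝ) :
    (thetaRatio τ : ℂ) = theta4 (I * τ) / jacobiTheta (I * τ) := by
  have h4 : theta4 (I * τ) = ((∑' m : ℤ, (-Real.exp (-Real.pi * τ)) ^ (m ^ 2) : ℝ) : ℂ) := by
    rw [theta4, Complex.ofReal_tsum]
    refine tsum_congr fun m => ?_
    push_cast
    congr 3
    linear_combination ((Real.pi : ℂ) * τ) * I_mul_I
  have h3 : jacobiTheta (I * τ) = ((∑' m : ℤ, Real.exp (-Real.pi * τ * m ^ 2) : ℝ) : ℂ) := by
    rw [jacobiTheta, Complex.ofReal_tsum]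
    refine tsum_congr fun m => ?_
    push_cast
    congr 1
    linear_combination ((Real.pi : ℂ) * τ * (m : ℂ) ^ 2) * I_mul_I
  rw [thetaRatio, h4, h3, ← Complex.ofReal_div, Complex.ofReal_re]

end Z4Secrecy

end

namespace Z4Secrecy

open HurwitzZeta

/-! Write `K s x` for `evenKernel s x`, the sum of `exp (-π (m + s)² x)` over integers `m`. At `iτ`,
ϑ₃ is `K 0 τ`, ϑ₂ is `K (1/2) τ`, and ϑ₄ is `cosKernel (1/2) τ`. Summing over the lattice codeword
by codeword gives the weight enumerator at `K 0`, `K (1/4)`, `K (1/2)`, all evaluated at `4τ`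
(`thetaSeries_constrA4`). Parity splittings turn these three values into (ϑ₃ + ϑ₄)/2, ϑ₂/2, (ϑ₃ -
ϑ₄)/2 at `τ`, and `jacobi_identity` expresses ϑ₂ through ϑ₃ and ϑ₄. By homogeneity the factor
(ϑ₃/2)ⁿ comes out and leaves `hFun` at `thetaRatio τ`. Formal self-duality enters only through the
size `2 ^ n` of the code, which makes the volume 1 and the numerator of the secrecy function ϑ₃ⁿ.
The extremal statements follow because `thetaRatio` maps the half-line onto the open unit interval
(`thetaRatio_image`) and `hFun` is positive there; injectivity is not needed. -/

theorem hasSum_add_of_isCompl_range {α β γ : Type*} {f : γ → ℝ} {g : α → γ} {h : β → γ} {a b : ℝ}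
    (hg : Function.Injective g) (hh : Function.Injective h)
    (hc : IsCompl (Set.range g) (Set.range h))
    (ha : HasSum (fun x => f (g x)) a) (hb : HasSum (fun x => f (h x)) b) : HasSum f (a + b) :=
  HasSum.add_isCompl hc (hg.hasSum_range_iff.2 ha) (hh.hasSum_range_iff.2 hb)

theorem hasSum_int_even_add_odd {f : ℤ → ℝ} {a b : ℝ} (ha : HasSum (fun m => f (2 * m)) a)
    (hb : HasSum (fun m => f (2 * m + 1)) b) : HasSum f (a + b) := by
  refine hasSum_add_of_isCompl_range (g := fun m : ℤ => 2 * m) (h := fun m : ℤ => 2 * m + 1)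
    (fun x y h => by grind) (fun x y h => by grind) ?_ ha hb
  rw [isCompl_iff, Set.disjoint_left, codisjoint_iff_le_sup]
  refine ⟨?_, ?_⟩
  · rintro _ ⟨x, rfl⟩ ⟨y, h⟩
    grind
  · intro m _
    rcases Int.even_or_odd' m with ⟨k, rfl | rfl⟩
    · exact Or.inl ⟨k, rfl⟩
    · exact Or.inr ⟨k, rfl⟩

/-- Summation over `ℤ²` along the two cosets of the sublattice `{(m, n) | m + n even}`. -/
theorem hasSum_int_prod_of_rotate {f : ℤ × ℤ → ℝ} {a b : ℝ}
    (ha : HasSum (fun x : ℤ × ℤ => f (x.1 + x.2, x.1 - x.2)) a)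
    (hb : HasSum (fun x : ℤ × ℤ => f (x.1 + x.2 + 1, x.1 - x.2)) b) : HasSum f (a + b) := by
  refine hasSum_add_of_isCompl_range (g := fun x : ℤ × ℤ => (x.1 + x.2, x.1 - x.2))
    (h := fun x : ℤ × ℤ => (x.1 + x.2 + 1, x.1 - x.2)) ?_ ?_ ?_ ha hb
  · rintro ⟨x, y⟩ ⟨z, w⟩ h
    simp only [Prod.mk.injEq] at h ⊢
    omega
  · rintro ⟨x, y⟩ ⟨z, w⟩ h
    simp only [Prod.mk.injEq] at h ⊢
    omega
  rw [isCompl_iff, Set.disjoint_left, codisjoint_iff_le_sup]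
  refine ⟨?_, ?_⟩
  · rintro _ ⟨⟨x, y⟩, rfl⟩ ⟨⟨z, w⟩, h⟩
    simp only [Prod.mk.injEq] at h
    omega
  · rintro ⟨m, n⟩ _
    rcases Int.even_or_odd' (m + n) with ⟨k, hk | hk⟩
    · refine Or.inl ⟨(k, m - k), ?_⟩
      simp only [Prod.mk.injEq]
      omega
    · refine Or.inr ⟨(k, m - k - 1), ?_⟩
      simp only [Prod.mk.injEq]
      omega

/-! ### Theta constants: decay, duplication formulas and Jacobi's identity -/

theorem evenKernel_pos (a : ℝ) {x : ℝ} (hx : 0 < x) : 0 < evenKernel a x := by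
  have h := hasSum_int_evenKernel a hx
  rw [← h.tsum_eq]
  exact h.summable.tsum_pos (fun m => (Real.exp_pos _).le) 0 (Real.exp_pos _)

theorem one_le_evenKernel_zero {x : ℝ} (hx : 0 < x) : 1 ≤ evenKernel (0 : ℝ) x := by
  have h := hasSum_int_evenKernel 0 hx
  simpa using le_hasSum h 0 (fun m _ => (Real.exp_pos _).le)

/-- Every `(m + 1/2)²` is at least `1/4`, so moving from `1` to `x` shrinks each term by at least
the stated factor. -/
theorem evenKernel_one_half_le {x : ℝ} (hx : 1 ≤ x) :
    evenKernel (1 / 2 : ℝ) x ≤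
      Real.exp (-Real.pi / 4 * (x - 1)) * evenKernel (1 / 2 : ℝ) 1 := by
  refine hasSum_le (fun m => ?_) (hasSum_int_evenKernel (1 / 2) (by linarith : 0 < x))
    ((hasSum_int_evenKernel (1 / 2) one_pos).mul_left _)
  rw [← Real.exp_add, Real.exp_le_exp]
  have h : (1 / 4 : ℝ) ≤ ((m : ℝ) + 1 / 2) ^ 2 := by
    have : (0 : ℤ) ≤ m * (m + 1) := by
      rcases le_or_gt 0 m with h | h <;> nlinarith
    have : (0 : ℝ) ≤ m * (m + 1) := by exact_mod_cast this
    nlinarith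
  have h2 : 0 ≤ Real.pi * ((((m : ℝ) + 1 / 2) ^ 2 - 1 / 4) * (x - 1)) :=
    mul_nonneg Real.pi_pos.le (mul_nonneg (by linarith) (by linarith))
  linarith

open Filter Topology in
theorem tendsto_evenKernel_one_half :
    Tendsto (evenKernel (1 / 2 : ℝ)) atTop (𝓝 0) := by
  have h : Tendsto (fun x : ℝ => Real.exp (-Real.pi / 4 * (x - 1)) * evenKernel (1 / 2 : ℝ) 1)
      atTop (𝓝 (0 * evenKernel (1 / 2 : ℝ) 1)) := by
    refine Tendsto.mul_const _ (Real.tendsto_exp_atBot.comp ?_)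
    refine Tendsto.const_mul_atTop_of_neg (by linarith [Real.pi_pos]) ?_
    exact tendsto_atTop_add_const_right _ _ tendsto_id
  rw [zero_mul] at h
  refine tendsto_of_tendsto_of_tendsto_of_le_of_le' tendsto_const_nhds h ?_ ?_
  · filter_upwards [eventually_gt_atTop 0] with x hx using (evenKernel_pos _ hx).le
  · filter_upwards [eventually_ge_atTop 1] with x hx using evenKernel_one_half_le hx

theorem hasSum_cosKernel_one_half {x : ℝ} (hx : 0 < x) :
    HasSum (fun m : ℤ => (-1 : ℝ) ^ m * Real.exp (-Real.pi * m ^ 2 * x))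
      (cosKernel (1 / 2 : ℝ) x) := by
  rw [← Complex.hasSum_ofReal]
  convert hasSum_int_cosKernel (1 / 2) hx using 2 with m
  have h : Complex.exp (2 * Real.pi * Complex.I * ((1 / 2 : ℝ) : ℂ) * m) = (-1) ^ m := by
    rw [← Complex.exp_pi_mul_I, ← Complex.exp_int_mul]
    congr 1
    push_cast
    ring
  rw [h]
  push_cast
  rfl

/-- Splitting the sum over `ℤ + s` according to the parity of the integer part. -/
theorem evenKernel_eq_add (s : ℝ) {x : ℝ} (hx : 0 < x) :
    evenKernel s x = evenKernel (s / 2 : ℝ) (4 * x) + evenKernel ((s + 1) / 2 : ℝ) (4 * x) := by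
  refine (hasSum_int_evenKernel s hx).unique (hasSum_int_even_add_odd ?_ ?_)
  · convert hasSum_int_evenKernel (s / 2) (by positivity : 0 < 4 * x) using 3 with m
    push_cast
    ring
  · convert hasSum_int_evenKernel ((s + 1) / 2) (by positivity : 0 < 4 * x) using 3 with m
    push_cast
    ring

theorem cosKernel_one_half_eq_sub {x : ℝ} (hx : 0 < x) :
    cosKernel (1 / 2 : ℝ) x = evenKernel (0 : ℝ) (4 * x) - evenKernel (1 / 2 : ℝ) (4 * x) := by
  rw [sub_eq_add_neg]
  refine (hasSum_cosKernel_one_half hx).unique (hasSum_int_even_add_odd ?_ ?_)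
  · convert hasSum_int_evenKernel 0 (by positivity : 0 < 4 * x) using 2 with m
    rw [Even.neg_one_zpow (by simp), one_mul]
    congr 1
    push_cast
    ring
  · refine (hasSum_int_evenKernel (1 / 2) (by positivity : 0 < 4 * x)).neg.congr_fun fun m => ?_
    rw [Odd.neg_one_zpow (by simp), neg_one_mul]
    congr 2
    push_cast
    ring

theorem hasSum_evenKernel_mul (s t : ℝ) {x : ℝ} (hx : 0 < x) :
    HasSum (fun p : ℤ × ℤ => Real.exp (-Real.pi * ((p.1 + s) ^ 2 + (p.2 + t) ^ 2) * x))
      (evenKernel s x * evenKernel t x) := by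
  have h1 := hasSum_int_evenKernel s hx
  have h2 := hasSum_int_evenKernel t hx
  refine (h1.mul h2 (h1.summable.mul_of_nonneg h2.summable
    (fun m => (Real.exp_pos _).le) (fun m => (Real.exp_pos _).le))).congr_fun fun p => ?_
  rw [← Real.exp_add]
  congr 1
  ring

/-- The duplication formula for products of theta functions with shifts. -/
theorem evenKernel_sq (s : ℝ) {x : ℝ} (hx : 0 < x) :
    evenKernel s x ^ 2 = evenKernel (s : ℝ) (2 * x) * evenKernel (0 : ℝ) (2 * x) +
      evenKernel (s + 1 / 2 : ℝ) (2 * x) * evenKernel (1 / 2 : ℝ) (2 * x) := by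
  rw [sq]
  refine (hasSum_evenKernel_mul s s hx).unique (hasSum_int_prod_of_rotate ?_ ?_)
  · convert hasSum_evenKernel_mul s 0 (by positivity : 0 < 2 * x) using 3 with p
    push_cast
    ring
  · convert hasSum_evenKernel_mul (s + 1 / 2) (1 / 2) (by positivity : 0 < 2 * x) using 3 with p
    push_cast
    ring

theorem evenKernel_zero_sq {x : ℝ} (hx : 0 < x) :
    evenKernel (0 : ℝ) x ^ 2 =
      evenKernel (0 : ℝ) (2 * x) ^ 2 + evenKernel (1 / 2 : ℝ) (2 * x) ^ 2 := by
  rw [evenKernel_sq 0 hx, zero_add]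
  ring

theorem evenKernel_one_half_sq {x : ℝ} (hx : 0 < x) :
    evenKernel (1 / 2 : ℝ) x ^ 2 =
      2 * evenKernel (0 : ℝ) (2 * x) * evenKernel (1 / 2 : ℝ) (2 * x) := by
  have h : (((1 / 2 + 1 / 2 : ℝ) : ℝ) : UnitAddCircle) = ((0 : ℝ) : UnitAddCircle) := by
    norm_num [AddCircle.coe_period]
  rw [evenKernel_sq (1 / 2) hx, h]
  ring

theorem evenKernel_zero_eq_add {x : ℝ} (hx : 0 < x) :
    evenKernel (0 : ℝ) x = evenKernel (0 : ℝ) (4 * x) + evenKernel (1 / 2 : ℝ) (4 * x) := by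
  simpa using evenKernel_eq_add 0 hx

/-- With `a = K 0 (4x)` and `b = K (1/2) (4x)`, the left side is `(a - b)²`, while duplication at
`2x` gives `a² + b²` and `2ab` for the two squares on the right. -/
theorem cosKernel_one_half_sq {x : ℝ} (hx : 0 < x) :
    cosKernel (1 / 2 : ℝ) x ^ 2 =
      evenKernel (0 : ℝ) (2 * x) ^ 2 - evenKernel (1 / 2 : ℝ) (2 * x) ^ 2 := by
  have h1 := evenKernel_zero_sq (by positivity : 0 < 2 * x)
  have h2 := evenKernel_one_half_sq (by positivity : 0 < 2 * x)
  rw [show 2 * (2 * x) = 4 * x by ring] at h1 h2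
  rw [cosKernel_one_half_eq_sub hx, h1, h2]
  ring

/-- Jacobi's identity `ϑ₂⁴ + ϑ₄⁴ = ϑ₃⁴`. -/
theorem jacobi_identity {x : ℝ} (hx : 0 < x) :
    evenKernel (1 / 2 : ℝ) x ^ 4 + cosKernel (1 / 2 : ℝ) x ^ 4 = evenKernel (0 : ℝ) x ^ 4 := by
  have h3 : evenKernel (0 : ℝ) x ^ 4 = (evenKernel (0 : ℝ) x ^ 2) ^ 2 := by ring
  have h4 : cosKernel (1 / 2 : ℝ) x ^ 4 = (cosKernel (1 / 2 : ℝ) x ^ 2) ^ 2 := by ring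
  have h2 : evenKernel (1 / 2 : ℝ) x ^ 4 = (evenKernel (1 / 2 : ℝ) x ^ 2) ^ 2 := by ring
  -- What remains is `(2ab)² + (a² - b²)² = (a² + b²)²`, with the kernels taken at `2x`.
  rw [h2, h3, h4, evenKernel_zero_sq hx, cosKernel_one_half_sq hx, evenKernel_one_half_sq hx]
  ring

/-- The shifts are opposite modulo 1 and the kernel is even; hence coordinates 1 and 3 can share a
variable. -/
theorem evenKernel_three_quarters (x : ℝ) :
    evenKernel (3 / 4 : ℝ) x = evenKernel (1 / 4 : ℝ) x := by
  have h : ((3 / 4 : ℝ) : UnitAddCircle) = -((1 / 4 : ℝ) : UnitAddCircle) := by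
    rw [eq_neg_iff_add_eq_zero, ← AddCircle.coe_add]
    norm_num [AddCircle.coe_period]
  rw [h, evenKernel_neg]

theorem two_mul_evenKernel_one_quarter {x : ℝ} (hx : 0 < x) :
    2 * evenKernel (1 / 4 : ℝ) (4 * x) = evenKernel (1 / 2 : ℝ) x := by
  have h := evenKernel_eq_add (1 / 2) hx
  norm_num [evenKernel_three_quarters] at h ⊢
  linarith

/-! ### The ratio `t(τ)` and its range -/

theorem jacobiTheta_eq_evenKernel (τ : ℝ) :
    jacobiTheta (Complex.I * τ) = (evenKernel (0 : ℝ) τ : ℂ) := by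
  rw [jacobiTheta_eq_jacobiTheta₂, evenKernel_def]
  simp

theorem theta4_eq_cosKernel {τ : ℝ} (hτ : 0 < τ) :
    theta4 (Complex.I * τ) = (cosKernel (1 / 2 : ℝ) τ : ℂ) := by
  rw [theta4, ← (hasSum_cosKernel_one_half hτ).tsum_eq, Complex.ofReal_tsum]
  refine tsum_congr fun m => ?_
  have h1 : (-1 : ℂ) ^ (m ^ 2) = (-1) ^ m := by
    rcases Int.even_or_odd m with h | h
    · rw [h.neg_one_zpow, Even.neg_one_zpow (h.pow_of_ne_zero two_ne_zero)]
    · rw [h.neg_one_zpow, Odd.neg_one_zpow h.pow]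
  rw [← neg_one_mul, mul_zpow, h1, ← Complex.exp_int_mul]
  push_cast
  congr 2
  linear_combination ((m : ℂ) ^ 2 * Real.pi * τ) * Complex.I_mul_I

theorem thetaRatio_eq {τ : ℝ} (hτ : 0 < τ) :
    thetaRatio τ = cosKernel (1 / 2 : ℝ) τ / evenKernel (0 : ℝ) τ := by
  rw [thetaRatio, theta4_eq_cosKernel hτ, jacobiTheta_eq_evenKernel, ← Complex.ofReal_div,
    Complex.ofReal_re]

/-- The functional equation trades the alternating sum ϑ₄ for a sum of positive terms, which makes
positivity and the limit at `τ → 0` visible. -/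
theorem thetaRatio_eq_inv {τ : ℝ} (hτ : 0 < τ) :
    thetaRatio τ = evenKernel (1 / 2 : ℝ) (1 / τ) / evenKernel (0 : ℝ) (1 / τ) := by
  have h0 : (((0 : ℝ) : ℝ) : UnitAddCircle) = 0 := AddCircle.coe_zero ..
  have h : (1 / τ) ^ (1 / 2 : ℝ) ≠ 0 := by positivity
  rw [thetaRatio_eq hτ, evenKernel_functional_equation _ (1 / τ),
    evenKernel_functional_equation _ (1 / τ), one_div_one_div, h0, evenKernel_eq_cosKernel_of_zero]
  field_simp

/-- In ϑ₃ - ϑ₄ the even-index terms cancel. The right side shows both that the ratio is below 1 and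
that it tends to 1 as `τ → ∞`. -/
theorem one_sub_thetaRatio {τ : ℝ} (hτ : 0 < τ) :
    1 - thetaRatio τ = 2 * evenKernel (1 / 2 : ℝ) (4 * τ) / evenKernel (0 : ℝ) τ := by
  have h := (evenKernel_pos 0 hτ).ne'
  rw [thetaRatio_eq hτ, eq_div_iff h, sub_mul, div_mul_cancel₀ _ h, cosKernel_one_half_eq_sub hτ,
    evenKernel_zero_eq_add hτ]
  ring

theorem thetaRatio_pos {τ : ℝ} (hτ : 0 < τ) : 0 < thetaRatio τ := by
  rw [thetaRatio_eq_inv hτ]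
  exact div_pos (evenKernel_pos _ (by positivity)) (evenKernel_pos _ (by positivity))

theorem thetaRatio_lt_one {τ : ℝ} (hτ : 0 < τ) : thetaRatio τ < 1 := by
  have h : 0 < 2 * evenKernel (1 / 2 : ℝ) (4 * τ) / evenKernel (0 : ℝ) τ :=
    div_pos (mul_pos two_pos (evenKernel_pos _ (by positivity))) (evenKernel_pos _ hτ)
  rw [← one_sub_thetaRatio hτ] at h
  linarith

theorem continuousOn_thetaRatio : ContinuousOn thetaRatio (Set.Ioi 0) := by
  refine ContinuousOn.congr (f := fun τ => cosKernel (1 / 2 : ℝ) τ / evenKernel (0 : ℝ) τ) ?_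
    fun τ hτ => thetaRatio_eq hτ
  exact (continuousOn_cosKernel _).div (continuousOn_evenKernel _)
    fun τ hτ => (evenKernel_pos 0 hτ).ne'

theorem exists_thetaRatio_lt {t : ℝ} (ht : 0 < t) : ∃ τ, 0 < τ ∧ thetaRatio τ < t := by
  obtain ⟨x, hxt, hx⟩ := ((tendsto_evenKernel_one_half.eventually_lt_const ht).and
    (Filter.eventually_gt_atTop 0)).exists
  refine ⟨1 / x, by positivity, ?_⟩
  rw [thetaRatio_eq_inv (by positivity), one_div_one_div]
  exact (div_le_self (evenKernel_pos _ hx).le (one_le_evenKernel_zero hx)).trans_lt hxt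

theorem exists_lt_thetaRatio {t : ℝ} (ht : t < 1) : ∃ τ, 0 < τ ∧ t < thetaRatio τ := by
  obtain ⟨x, hxt, hx⟩ := ((tendsto_evenKernel_one_half.eventually_lt_const
    (by linarith : 0 < (1 - t) / 2)).and (Filter.eventually_gt_atTop 0)).exists
  -- Chosen so that `4τ = x`; the threshold `(1 - t) / 2` absorbs the factor 2 in
  -- `one_sub_thetaRatio`.
  refine ⟨x / 4, by positivity, ?_⟩
  have h := one_sub_thetaRatio (by positivity : 0 < x / 4)
  rw [mul_div_cancel₀ _ four_ne_zero] at h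
  have h2 := div_le_self (mul_pos two_pos (evenKernel_pos (1 / 2) hx)).le
    (one_le_evenKernel_zero (by positivity : 0 < x / 4))
  linarith

theorem thetaRatio_image : thetaRatio '' Set.Ioi 0 = Set.Ioo 0 1 := by
  apply Set.Subset.antisymm
  · rintro _ ⟨τ, hτ, rfl⟩
    exact ⟨thetaRatio_pos hτ, thetaRatio_lt_one hτ⟩
  · rintro t ⟨h0, h1⟩
    obtain ⟨a, ha, hat⟩ := exists_thetaRatio_lt h0
    obtain ⟨b, hb, hbt⟩ := exists_lt_thetaRatio h1
    exact isPreconnected_Ioi.intermediate_value ha hb continuousOn_thetaRatio ⟨hat.le, hbt.le⟩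

open MeasureTheory

/-! ### Cardinality of a formally self-dual code -/

-- Sum the character of the inner product over `C × (ℤ/4)ⁿ` in both orders: summing over `C` first
-- keeps only dual vectors, summing over the whole space first keeps only the zero codeword.
open Classical in
theorem card_mul_card_dualCode {n : ℕ} (C : AddSubgroup (Fin n → ZMod 4)) :
    Nat.card C * Nat.card (dualCode C) = 4 ^ n := by
  have hψ := (ZMod.isPrimitive_stdAddChar 4)
  have key1 (x : Fin n → ZMod 4) :
      ∑ y : C, (ZMod.stdAddChar (∑ j, x j * (y : Fin n → ZMod 4) j) : ℂ) =
        if x ∈ dualCode C then (Nat.card C : ℂ) else 0 := by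
    let χ : AddChar C ℂ :=
      { toFun := fun y => ZMod.stdAddChar (∑ j, x j * (y : Fin n → ZMod 4) j)
        map_zero_eq_one' := by simp
        map_add_eq_mul' := fun a b => by
          simp [mul_add, Finset.sum_add_distrib, AddChar.map_add_eq_mul] }
    have h1 : χ = 0 ↔ x ∈ dualCode C := by
      rw [AddChar.ext_iff]
      constructor
      · intro h y hy
        apply ZMod.injective_stdAddChar
        simpa [χ] using h ⟨y, hy⟩
      · intro h y
        have := h y y.2
        change ZMod.stdAddChar (∑ j, x j * (y : Fin n → ZMod 4) j) = 1
        rw [this, AddChar.map_zero_eq_one]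
    have h2 := χ.sum_eq_ite
    simp only [h1] at h2
    rw [Nat.card_eq_fintype_card]
    exact h2
  have key2 (y : Fin n → ZMod 4) :
      ∑ x : Fin n → ZMod 4, (ZMod.stdAddChar (∑ j, x j * y j) : ℂ) =
        if y = 0 then (4 ^ n : ℂ) else 0 := by
    let χ : AddChar (Fin n → ZMod 4) ℂ :=
      { toFun := fun x => ZMod.stdAddChar (∑ j, x j * y j)
        map_zero_eq_one' := by simp
        map_add_eq_mul' := fun a b => by
          simp [add_mul, Finset.sum_add_distrib, AddChar.map_add_eq_mul] }
    have h1 : χ = 0 ↔ y = 0 := by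
      rw [AddChar.ext_iff]
      constructor
      · intro h
        funext i
        apply ZMod.injective_stdAddChar
        -- Testing against a unit vector isolates the coordinate `y i`.
        simpa [χ, Pi.single_apply] using h (Pi.single i 1)
      · rintro rfl x
        simp [χ]
    have h2 := χ.sum_eq_ite
    simp only [h1] at h2
    refine Eq.trans h2 ?_
    simp [ZMod.card]
  have h : (Nat.card C * Nat.card (dualCode C) : ℂ) = 4 ^ n := by
    calc (Nat.card C * Nat.card (dualCode C) : ℂ)
        = ∑ x : Fin n → ZMod 4, if x ∈ dualCode C then (Nat.card C : ℂ) else 0 := by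
          rw [← Finset.sum_filter, Finset.sum_const, nsmul_eq_mul, mul_comm,
            Nat.card_eq_fintype_card (α := dualCode C), Fintype.card_subtype]
      _ = ∑ y : C, ∑ x : Fin n → ZMod 4,
            (ZMod.stdAddChar (∑ j, x j * (y : Fin n → ZMod 4) j) : ℂ) := by
          rw [Finset.sum_comm]
          exact Finset.sum_congr rfl fun x _ => (key1 x).symm
      _ = ∑ y : C, if y = 0 then (4 ^ n : ℂ) else 0 := by
          refine Finset.sum_congr rfl fun y _ => ?_
          rw [key2]
          simp
      _ = 4 ^ n := by simp
  exact_mod_cast h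

open Classical in
theorem aeval_swe {n : ℕ} (C : AddSubgroup (Fin n → ZMod 4)) (a b c : ℝ) :
    MvPolynomial.aeval ![a, b, c] (swe C) = ∑ w : Fin n → ZMod 4 with w ∈ C,
      a ^ coordCount 0 w * b ^ (coordCount 1 w + coordCount 3 w) * c ^ coordCount 2 w := by
  simp [swe]

open Classical in
theorem aeval_swe_one {n : ℕ} (C : AddSubgroup (Fin n → ZMod 4)) :
    MvPolynomial.aeval ![(1 : ℝ), 1, 1] (swe C) = Nat.card C := by
  rw [aeval_swe, Nat.card_eq_fintype_card, Fintype.card_subtype]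
  simp

theorem FormallySelfDual.card_eq {n : ℕ} {C : AddSubgroup (Fin n → ZMod 4)}
    (hC : FormallySelfDual C) : Nat.card C = 2 ^ n := by
  have h1 : (Nat.card C : ℝ) = Nat.card (dualCode C) := by
    rw [← aeval_swe_one, ← aeval_swe_one, hC]
  have h2 : Nat.card C = Nat.card (dualCode C) := by exact_mod_cast h1
  have h3 := card_mul_card_dualCode C
  rw [← h2, ← sq, show 4 ^ n = (2 ^ n) ^ 2 by rw [← pow_mul, mul_comm, pow_mul]; norm_num] at h3
  exact Nat.pow_left_injective two_ne_zero h3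

/-- Constant `f` gives homogeneity of the enumerator; theta kernels as `f` give the contribution of
one codeword. -/
theorem prod_comp_eq_pow_coordCount {n : ℕ} (w : Fin n → ZMod 4) (f : ZMod 4 → ℝ) :
    ∏ j, f (w j) = f 0 ^ coordCount 0 w * f 1 ^ coordCount 1 w * f 2 ^ coordCount 2 w *
      f 3 ^ coordCount 3 w := by
  rw [← Finset.prod_fiberwise Finset.univ w]
  have h (i : ZMod 4) : ∏ j with w j = i, f (w j) = f i ^ coordCount i w := by
    rw [coordCount, Finset.prod_congr rfl fun j hj => by rw [(Finset.mem_filter.1 hj).2],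
      Finset.prod_const]
  simp only [h]
  exact Fin.prod_univ_four (fun i : Fin 4 => f i ^ coordCount (n := n) i w)

/-- The symmetrized weight enumerator is homogeneous of degree `n`. -/
theorem aeval_swe_smul {n : ℕ} (C : AddSubgroup (Fin n → ZMod 4)) (r a b c : ℝ) :
    MvPolynomial.aeval ![r * a, r * b, r * c] (swe C) =
      r ^ n * MvPolynomial.aeval ![a, b, c] (swe C) := by
  rw [aeval_swe, aeval_swe, Finset.mul_sum]
  refine Finset.sum_congr rfl fun w _ => ?_
  have h := prod_comp_eq_pow_coordCount w (fun _ => r)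
  rw [Finset.prod_const, Finset.card_univ, Fintype.card_fin] at h
  rw [h]
  ring

/-! ### Volume of the Construction A₄ lattice -/

/-- The embedding `z ↦ z / 2` of `ℤⁿ`. -/
noncomputable def halfInt (n : ℕ) : (Fin n → ℤ) →+ EuclideanSpace ℝ (Fin n) where
  toFun z := WithLp.toLp 2 fun j => (1 / 2 : ℝ) * z j
  map_zero' := by ext; simp
  map_add' x y := by ext; simp; ring

/-- Reduction modulo `4`. -/
def modFour (n : ℕ) : (Fin n → ℤ) →+ (Fin n → ZMod 4) where
  toFun z j := z j
  map_zero' := by ext; simp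
  map_add' x y := by ext; simp

theorem halfInt_injective (n : ℕ) : Function.Injective (halfInt n) := by
  intro x y h
  funext j
  have := congrArg (fun v : EuclideanSpace ℝ (Fin n) => v j) h
  simpa [halfInt] using this

theorem modFour_surjective (n : ℕ) : Function.Surjective (modFour n) := by
  intro c
  exact ⟨fun j => (c j).val, by ext j; simp [modFour]⟩

/-- In this form lattice indices transfer to indices of codes, through an injective and a surjective
homomorphism. -/
theorem constrA4_toAddSubgroup {n : ℕ} (C : AddSubgroup (Fin n → ZMod 4)) :
    (constrA4 C).toAddSubgroup = (C.comap (modFour n)).map (halfInt n) := by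
  have h4 : (4 : ZMod 4) = 0 := rfl
  ext x
  constructor
  · rintro ⟨c, hc, z, hz⟩
    refine ⟨fun j => (c j).val + 4 * z j, ?_, ?_⟩
    · change modFour n _ ∈ C
      convert hc
      ext j
      simp [modFour, h4]
    · ext j
      simp [halfInt, hz]
  · rintro ⟨z, hz, rfl⟩
    refine ⟨modFour n z, hz, fun j => z j / 4, fun j => ?_⟩
    have h : ((modFour n z j).val : ℤ) + 4 * (z j / 4) = z j := by
      have h1 : ((modFour n z j).val : ℤ) = z j % 4 := ZMod.val_intCast (n := 4) (z j)
      omega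
    have h' : ((modFour n z j).val : ℝ) + 4 * ((z j / 4 : ℤ) : ℝ) = z j := by exact_mod_cast h
    rw [h']
    rfl

theorem relIndex_constrA4 {n : ℕ} (C : AddSubgroup (Fin n → ZMod 4)) :
    (constrA4 (⊥ : AddSubgroup (Fin n → ZMod 4))).toAddSubgroup.relIndex
      (constrA4 C).toAddSubgroup = Nat.card C := by
  rw [constrA4_toAddSubgroup, constrA4_toAddSubgroup,
    AddSubgroup.relIndex_map_map_of_injective _ _ (halfInt_injective n),
    AddSubgroup.relIndex_comap,
    AddSubgroup.map_comap_eq_self_of_surjective (modFour_surjective n),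
    AddSubgroup.relIndex_bot_left]

/-- The zero code gives `2ℤⁿ`, with the cube `[0, 2)ⁿ` as fundamental domain. -/
theorem covolume_constrA4_bot (n : ℕ) :
    ZLattice.covolume (constrA4 (⊥ : AddSubgroup (Fin n → ZMod 4))) = 2 ^ n := by
  let F : Set (Fin n → ℝ) := Set.univ.pi fun _ => Set.Ico 0 2
  have hF : MeasurableSet F := MeasurableSet.univ_pi fun _ => measurableSet_Ico
  have hmp := PiLp.volume_preserving_ofLp (Fin n)
  have hdom : IsAddFundamentalDomain (constrA4 (⊥ : AddSubgroup (Fin n → ZMod 4)))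
      (WithLp.ofLp ⁻¹' F : Set (EuclideanSpace ℝ (Fin n))) := by
    refine IsAddFundamentalDomain.mk' (hmp.measurable hF).nullMeasurableSet fun x => ?_
    refine ⟨⟨WithLp.toLp 2 fun j => 2 * ((-⌊x j / 2⌋ : ℤ) : ℝ), 0, rfl, fun j => -⌊x j / 2⌋,
      fun j => by simp; ring⟩, ?_, ?_⟩
    · intro j _
      have h1 := Int.floor_le (x j / 2)
      have h2 := Int.lt_floor_add_one (x j / 2)
      change 2 * ((-⌊x j / 2⌋ : ℤ) : ℝ) + x j ∈ Set.Ico (0 : ℝ) 2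
      push_cast
      constructor <;> linarith
    · rintro ⟨v, c, hc, z, hz⟩ hv
      obtain rfl : c = 0 := hc
      apply Subtype.ext
      ext j
      have h := hv j trivial
      change v j + x j ∈ Set.Ico (0 : ℝ) 2 at h
      change v j = 2 * ((-⌊x j / 2⌋ : ℤ) : ℝ)
      have hzj : v j = 2 * z j := by rw [hz j]; simp; ring
      rw [hzj] at h ⊢
      have : ⌊x j / 2⌋ = -z j := by
        rw [Int.floor_eq_iff]
        push_cast
        constructor <;> linarith [h.1, h.2]
      rw [this, neg_neg]
  rw [ZLattice.covolume_eq_measure_fundamentalDomain _ _ hdom, Measure.real,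
    hmp.measure_preimage hF.nullMeasurableSet, Real.volume_pi_Ico_toReal]
  · simp
  · intro _
    norm_num

theorem covolume_constrA4 {n : ℕ} (C : AddSubgroup (Fin n → ZMod 4)) :
    ZLattice.covolume (constrA4 C) = 2 ^ n / Nat.card C := by
  have hle : constrA4 (⊥ : AddSubgroup (Fin n → ZMod 4)) ≤ constrA4 C := by
    rintro x ⟨c, hc, z, hz⟩
    obtain rfl : c = 0 := hc
    exact ⟨0, C.zero_mem, z, hz⟩
  have h := ZLattice.covolume_div_covolume_eq_relIndex' _ _ hle
  rw [relIndex_constrA4, covolume_constrA4_bot] at h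
  rw [← h, div_div_cancel₀ (by positivity)]

theorem FormallySelfDual.covolume_eq_one {n : ℕ} {C : AddSubgroup (Fin n → ZMod 4)}
    (hC : FormallySelfDual C) : ZLattice.covolume (constrA4 C) = 1 := by
  rw [covolume_constrA4, hC.card_eq]
  simp

/-! ### Theta series -/

/-- Induction peels off one coordinate; nonnegativity supplies the summability of the product
family. -/
theorem hasSum_pi_prod {n : ℕ} {f : Fin n → ℤ → ℝ} {a : Fin n → ℝ} (h0 : ∀ j m, 0 ≤ f j m)
    (hf : ∀ j, HasSum (f j) (a j)) :
    HasSum (fun z : Fin n → ℤ => ∏ j, f j (z j)) (∏ j, a j) := by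
  induction n with
  | zero => simp
  | succ n ih =>
    have h1 := ih (f := fun j => f j.succ) (fun j => h0 j.succ) (fun j => hf j.succ)
    have hs : Summable fun p : ℤ × (Fin n → ℤ) => f 0 p.1 * ∏ j : Fin n, f j.succ (p.2 j) :=
      Summable.mul_of_nonneg (f := f 0) (g := fun z : Fin n → ℤ => ∏ j : Fin n, f j.succ (z j))
        (hf 0).summable h1.summable (fun m => h0 0 m)
        (fun z => Finset.prod_nonneg fun j _ => h0 j.succ (z j))
    rw [Fin.prod_univ_succ, ← (Fin.consEquiv fun _ => ℤ).hasSum_iff]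
    refine ((hf 0).mul h1 hs).congr_fun fun p => ?_
    simp [Fin.prod_univ_succ, Fin.consEquiv]

/-- A shifted version of `ℤⁿ` has the expected product theta series. -/
theorem hasSum_prod_exp {n : ℕ} (s : Fin n → ℝ) {x : ℝ} (hx : 0 < x) :
    HasSum (fun z : Fin n → ℤ => Real.exp (-Real.pi * (∑ j, (z j + s j) ^ 2) * x))
      (∏ j, evenKernel (s j : ℝ) x) := by
  refine (hasSum_pi_prod (f := fun j m => Real.exp (-Real.pi * (m + s j) ^ 2 * x))
    (fun j m => (Real.exp_pos _).le) fun j => hasSum_int_evenKernel (s j) hx).congr_fun fun z => ?_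
  rw [← Real.exp_sum, Finset.mul_sum, Finset.sum_mul]

theorem thetaSeries_scaledIntLattice_one (n : ℕ) {τ : ℝ} (hτ : 0 < τ) :
    thetaSeries (scaledIntLattice n 1) (Complex.I * τ) =
      ((evenKernel (0 : ℝ) τ ^ n : ℝ) : ℂ) := by
  rw [thetaSeries_imag]
  congr 1
  let e : (Fin n → ℤ) → scaledIntLattice n 1 :=
    fun z => ⟨WithLp.toLp 2 fun j => (z j : ℝ), z, fun j => by simp⟩
  have he : Function.Bijective e := by
    constructor
    · intro x y h
      funext j
      have := congrArg (fun v : scaledIntLattice n 1 => (v : EuclideanSpace ℝ (Fin n)) j) h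
      simpa [e] using this
    · rintro ⟨v, z, hz⟩
      refine ⟨z, Subtype.ext ?_⟩
      ext j
      simp [e, hz]
  rw [← (Equiv.ofBijective e he).tsum_eq]
  have h := hasSum_prod_exp (fun _ : Fin n => 0) hτ
  rw [Finset.prod_const, Finset.card_univ, Fintype.card_fin] at h
  rw [← h.tsum_eq]
  refine tsum_congr fun z => ?_
  simp only [Equiv.ofBijective_apply, e, EuclideanSpace.real_norm_sq_eq, add_zero]
  congr 1
  ring

theorem thetaSeries_constrA4 {n : ℕ} (C : AddSubgroup (Fin n → ZMod 4)) {τ : ℝ} (hτ : 0 < τ) :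
    thetaSeries (constrA4 C) (Complex.I * τ) =
      ((MvPolynomial.aeval ![evenKernel (0 : ℝ) (4 * τ), evenKernel (1 / 4 : ℝ) (4 * τ),
        evenKernel (1 / 2 : ℝ) (4 * τ)] (swe C) : ℝ) : ℂ) := by
  classical
  rw [thetaSeries_imag]
  congr 1
  let e : C × (Fin n → ℤ) → constrA4 C :=
    fun p => ⟨WithLp.toLp 2 fun j => (1 / 2 : ℝ) * (((p.1 : Fin n → ZMod 4) j).val + 4 * p.2 j),
      p.1, p.1.2, p.2, fun j => rfl⟩
  have he : Function.Bijective e := by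
    constructor
    · rintro ⟨⟨c, hc⟩, z⟩ ⟨⟨d, hd⟩, w⟩ h
      have key (j : Fin n) : ((c j).val : ℤ) + 4 * z j = (d j).val + 4 * w j := by
        have h := congrArg (fun v : constrA4 C => (v : EuclideanSpace ℝ (Fin n)) j) h
        have h' : ((c j).val : ℝ) + 4 * z j = (d j).val + 4 * w j := by simpa [e] using h
        exact_mod_cast h'
      have hval (j : Fin n) : (c j).val = (d j).val := by
        have h1 := ZMod.val_lt (c j)
        have h2 := ZMod.val_lt (d j)
        have := key j
        omega
      obtain rfl : c = d := funext fun j => ZMod.val_injective 4 (hval j)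
      obtain rfl : z = w := funext fun j => by have := key j; omega
      rfl
    · rintro ⟨v, c, hc, z, hz⟩
      refine ⟨⟨⟨c, hc⟩, z⟩, Subtype.ext ?_⟩
      ext j
      simp [e, hz]
  rw [← (Equiv.ofBijective e he).tsum_eq]
  -- A coordinate `(c + 4z)/2` has square `4 (z + c/4)²`: hence the shifts `c/4` and the argument
  -- `4τ`.
  have hnorm (p : C × (Fin n → ℤ)) :
      Real.exp (-Real.pi * τ * ‖(e p : EuclideanSpace ℝ (Fin n))‖ ^ 2) = Real.exp (-Real.pi *
        (∑ j, (p.2 j + (((p.1 : Fin n → ZMod 4) j).val : ℝ) / 4) ^ 2) * (4 * τ)) := by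
    congr 1
    simp only [e, EuclideanSpace.real_norm_sq_eq, Finset.mul_sum, Finset.sum_mul]
    exact Finset.sum_congr rfl fun j _ => by ring
  have hfib (c : C) := hasSum_prod_exp
    (fun j => (((c : Fin n → ZMod 4) j).val : ℝ) / 4) (by positivity : 0 < 4 * τ)
  simp only [Equiv.ofBijective_apply, hnorm]
  have hsum : Summable fun p : C × (Fin n → ℤ) => Real.exp (-Real.pi *
        (∑ j, (p.2 j + (((p.1 : Fin n → ZMod 4) j).val : ℝ) / 4) ^ 2) * (4 * τ)) :=
    (summable_prod_of_nonneg fun _ => (Real.exp_pos _).le).2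
      ⟨fun c => (hfib c).summable, Summable.of_finite⟩
  rw [hsum.tsum_prod' fun c => (hfib c).summable, tsum_fintype, aeval_swe]
  rw [Finset.sum_subtype (p := fun w => w ∈ C) _ (by simp)]
  refine Finset.sum_congr rfl fun c _ => ?_
  rw [(hfib c).tsum_eq, prod_comp_eq_pow_coordCount (c : Fin n → ZMod 4)
    fun i => evenKernel ((i.val : ℝ) / 4 : ℝ) (4 * τ)]
  have h0 : ((0 : ZMod 4).val : ℝ) / 4 = 0 := by simp
  have h1 : ((1 : ZMod 4).val : ℝ) / 4 = 1 / 4 := by norm_num [show (1 : ZMod 4).val = 1 from rfl]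
  have h2 : ((2 : ZMod 4).val : ℝ) / 4 = 1 / 2 := by norm_num [show (2 : ZMod 4).val = 2 from rfl]
  have h3 : ((3 : ZMod 4).val : ℝ) / 4 = 3 / 4 := by norm_num [show (3 : ZMod 4).val = 3 from rfl]
  simp only [h0, h1, h2, h3, evenKernel_three_quarters]
  ring

/-- Jacobi's identity divided by ϑ₃⁴; positivity of ϑ₂/ϑ₃ selects the real fourth root. -/
theorem one_sub_thetaRatio_pow_four {τ : ℝ} (hτ : 0 < τ) :
    (1 - thetaRatio τ ^ 4) ^ (1 / 4 : ℝ) =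
      evenKernel (1 / 2 : ℝ) τ / evenKernel (0 : ℝ) τ := by
  have h := (evenKernel_pos 0 hτ).ne'
  have h1 : 1 - thetaRatio τ ^ 4 = (evenKernel (1 / 2 : ℝ) τ / evenKernel (0 : ℝ) τ) ^ 4 := by
    rw [thetaRatio_eq hτ, div_pow, div_pow, eq_div_iff (pow_ne_zero 4 h), sub_mul,
      div_mul_cancel₀ _ (pow_ne_zero 4 h), ← jacobi_identity hτ]
    ring
  rw [h1, show (1 / 4 : ℝ) = ((4 : ℕ) : ℝ)⁻¹ by norm_num]
  exact Real.pow_rpow_inv_natCast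
    (div_nonneg (evenKernel_pos _ hτ).le (evenKernel_pos _ hτ).le) four_ne_zero

theorem thetaSeries_constrA4_eq_hFun {n : ℕ} (C : AddSubgroup (Fin n → ZMod 4)) {τ : ℝ}
    (hτ : 0 < τ) : thetaSeries (constrA4 C) (Complex.I * τ) =
      ((evenKernel (0 : ℝ) τ ^ n * (hFun C (thetaRatio τ) / 2 ^ n) : ℝ) : ℂ) := by
  have h := (evenKernel_pos 0 hτ).ne'
  have hA : evenKernel (0 : ℝ) (4 * τ) = evenKernel (0 : ℝ) τ / 2 * (1 + thetaRatio τ) := by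
    rw [thetaRatio_eq hτ, mul_add, mul_one, div_mul_div_comm, mul_comm 2,
      mul_div_mul_left _ _ h, cosKernel_one_half_eq_sub hτ, evenKernel_zero_eq_add hτ]
    ring
  have hC : evenKernel (1 / 2 : ℝ) (4 * τ) = evenKernel (0 : ℝ) τ / 2 * (1 - thetaRatio τ) := by
    rw [one_sub_thetaRatio hτ]
    field_simp
  have hB : evenKernel (1 / 4 : ℝ) (4 * τ) =
      evenKernel (0 : ℝ) τ / 2 * (1 - thetaRatio τ ^ 4) ^ (1 / 4 : ℝ) := by
    rw [one_sub_thetaRatio_pow_four hτ, ← two_mul_evenKernel_one_quarter hτ]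
    field_simp
  rw [thetaSeries_constrA4 C hτ, hA, hB, hC, aeval_swe_smul, hFun, div_pow]
  congr 1
  ring

theorem FormallySelfDual.secrecyFunction_eq {n : ℕ} {C : AddSubgroup (Fin n → ZMod 4)}
    (hC : FormallySelfDual C) {τ : ℝ} (hτ : 0 < τ) :
    secrecyFunction (constrA4 C) τ = 2 ^ n / hFun C (thetaRatio τ) := by
  have h := pow_ne_zero n (evenKernel_pos 0 hτ).ne'
  -- Since the volume is 1, the exponent `1 / n` is irrelevant, including its value 0 at `n = 0`.
  rw [secrecyFunction, hC.covolume_eq_one, Real.one_rpow, thetaSeries_scaledIntLattice_one n hτ,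
    thetaSeries_constrA4_eq_hFun C hτ, ← Complex.ofReal_div, Complex.ofReal_re,
    div_mul_cancel_left₀ h, inv_div]

/-- The zero codeword alone contributes `(1 + t) ^ n` to `hFun C t`. -/
theorem one_le_hFun {n : ℕ} (C : AddSubgroup (Fin n → ZMod 4)) {t : ℝ}
    (ht : t ∈ Set.Ioo (0 : ℝ) 1) : 1 ≤ hFun C t := by
  classical
  obtain ⟨h0, h1⟩ := ht
  have h4 : t ^ 4 ≤ 1 := pow_le_one₀ h0.le h1.le
  have hb : 0 ≤ (1 - t ^ 4) ^ (1 / 4 : ℝ) := Real.rpow_nonneg (by linarith) _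
  rw [hFun, aeval_swe]
  have hmem : (0 : Fin n → ZMod 4) ∈ Finset.univ.filter (fun w => w ∈ C) := by
    simp [C.zero_mem]
  refine le_trans ?_ (Finset.single_le_sum (fun w _ => ?_) hmem)
  · have e1 : coordCount 1 (0 : Fin n → ZMod 4) = 0 := by
      simp [coordCount, show (0 : ZMod 4) ≠ 1 by decide]
    have e2 : coordCount 2 (0 : Fin n → ZMod 4) = 0 := by
      simp [coordCount, show (0 : ZMod 4) ≠ 2 by decide]
    have e3 : coordCount 3 (0 : Fin n → ZMod 4) = 0 := by
      simp [coordCount, show (0 : ZMod 4) ≠ 3 by decide]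
    rw [e1, e2, e3, add_zero, pow_zero, pow_zero, mul_one, mul_one]
    exact one_le_pow₀ (by linarith)
  · have h2 : 0 ≤ 1 - t := by linarith
    positivity

end Z4Secrecy

/-! ### Transfer of extrema between the secrecy function and `hFun` -/

open Z4Secrecy in
theorem mainTheorem1 {n : ℕ} (C : AddSubgroup (Fin n → ZMod 4))
    (hC : Z4Secrecy.FormallySelfDual C) :
    (∀ τ : ℝ, 0 < τ → 0 < Z4Secrecy.thetaRatio τ ∧ Z4Secrecy.thetaRatio τ < 1 ∧
      (Z4Secrecy.secrecyFunction (Z4Secrecy.constrA4 C) τ)⁻¹ =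
        Z4Secrecy.hFun C (Z4Secrecy.thetaRatio τ) / 2 ^ n) ∧
    (∀ τ₀ : ℝ, 0 < τ₀ →
      (IsMaxOn (Z4Secrecy.secrecyFunction (Z4Secrecy.constrA4 C)) (Set.Ioi 0) τ₀ ↔
        IsMinOn (Z4Secrecy.hFun C) (Set.Ioo 0 1) (Z4Secrecy.thetaRatio τ₀))) ∧
    (∀ t₀ ∈ Set.Ioo (0 : ℝ) 1,
      (IsMinOn (Z4Secrecy.hFun C) (Set.Ioo 0 1) t₀ ↔
        ∃ τ₀ : ℝ, 0 < τ₀ ∧ Z4Secrecy.thetaRatio τ₀ = t₀ ∧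
          IsMaxOn (Z4Secrecy.secrecyFunction (Z4Secrecy.constrA4 C)) (Set.Ioi 0) τ₀)) ∧
    (∃ m : ℝ, 0 < m ∧ IsGLB (Z4Secrecy.hFun C '' Set.Ioo 0 1) m ∧
      IsLUB (Z4Secrecy.secrecyFunction (Z4Secrecy.constrA4 C) '' Set.Ioi 0) (2 ^ n / m)) := by
  have hmem {τ : ℝ} (hτ : 0 < τ) : thetaRatio τ ∈ Set.Ioo (0 : ℝ) 1 :=
    ⟨thetaRatio_pos hτ, thetaRatio_lt_one hτ⟩
  have hsurj {t : ℝ} (ht : t ∈ Set.Ioo (0 : ℝ) 1) : ∃ τ, 0 < τ ∧ thetaRatio τ = t := by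
    rw [← thetaRatio_image] at ht
    exact ht
  have hpos {t : ℝ} (ht : t ∈ Set.Ioo (0 : ℝ) 1) : 0 < hFun C t :=
    one_pos.trans_le (one_le_hFun C ht)
  have h2 : (0 : ℝ) < 2 ^ n := by positivity
  have hmax (τ₀ : ℝ) (hτ₀ : 0 < τ₀) : IsMaxOn (secrecyFunction (constrA4 C)) (Set.Ioi 0) τ₀ ↔
      IsMinOn (hFun C) (Set.Ioo 0 1) (thetaRatio τ₀) := by
    rw [isMaxOn_iff, isMinOn_iff]
    constructor
    · intro h t ht
      obtain ⟨τ, hτ, rfl⟩ := hsurj ht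
      have := h τ hτ
      rwa [hC.secrecyFunction_eq hτ, hC.secrecyFunction_eq hτ₀,
        div_le_div_iff_of_pos_left h2 (hpos ht) (hpos (hmem hτ₀))] at this
    · intro h τ hτ
      rw [hC.secrecyFunction_eq hτ, hC.secrecyFunction_eq hτ₀,
        div_le_div_iff_of_pos_left h2 (hpos (hmem hτ)) (hpos (hmem hτ₀))]
      exact h _ (hmem hτ)
  refine ⟨fun τ hτ => ⟨thetaRatio_pos hτ, thetaRatio_lt_one hτ, ?_⟩, hmax, ?_, ?_⟩
  · rw [hC.secrecyFunction_eq hτ, inv_div]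
  · intro t₀ ht₀
    constructor
    · intro h
      obtain ⟨τ₀, hτ₀, rfl⟩ := hsurj ht₀
      exact ⟨τ₀, hτ₀, rfl, (hmax τ₀ hτ₀).2 h⟩
    · rintro ⟨τ₀, hτ₀, rfl, h⟩
      exact (hmax τ₀ hτ₀).1 h
  · have hne : (hFun C '' Set.Ioo 0 1).Nonempty := Set.Nonempty.image _ ⟨1 / 2, by norm_num⟩
    have hlb : 1 ∈ lowerBounds (hFun C '' Set.Ioo 0 1) := by
      rintro _ ⟨t, ht, rfl⟩
      exact one_le_hFun C ht
    have hglb := isGLB_csInf hne ⟨1, hlb⟩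
    have hm := one_pos.trans_le (hglb.2 hlb)
    refine ⟨_, hm, hglb, ?_, ?_⟩
    · rintro _ ⟨τ, hτ, rfl⟩
      rw [hC.secrecyFunction_eq hτ, div_le_div_iff_of_pos_left h2 (hpos (hmem hτ)) hm]
      exact hglb.1 ⟨_, hmem hτ, rfl⟩
    · intro b hb
      have hb' {t : ℝ} (ht : t ∈ Set.Ioo (0 : ℝ) 1) : 2 ^ n / hFun C t ≤ b := by
        obtain ⟨τ, hτ, rfl⟩ := hsurj ht
        rw [← hC.secrecyFunction_eq hτ]
        exact hb ⟨τ, hτ, rfl⟩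
      -- Positivity of `b` allows `2 ^ n / hFun C t ≤ b` to be inverted into the lower bound `2 ^ n
      -- / b` for `hFun C`.
      have hb0 : 0 < b :=
        (div_pos h2 (hpos (t := 1 / 2) (by norm_num))).trans_le (hb' (by norm_num))
      rw [div_le_comm₀ hm hb0]
      apply hglb.2
      rintro _ ⟨t, ht, rfl⟩
      rw [div_le_comm₀ hb0 (hpos ht)]
      exact hb' ht
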